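/- Let $k\ge 1$ be an integer. A $k$-operation of arity $n\ge 1$ on $\{0,1\}$ is a $k$-tuple $\boldsymbol f=(f^{(1)},\dots,f^{(k)})$ of functions $\{0,1\}^n\to\{0,1\}$. A $k$-clone on $\{0,1\}$ is a set of $k$-operations (of arbitrary arities $n\ge 1$) which, for all $1\le i\le n$, contains the projection $k$-operation all of whose $k$ components are $(x_1,\dots,x_n)\mapsto x_i$, and which is closed under coordinatewise composition: if it contains $\boldsymbol f$ of arity $m$ and $\boldsymbol g_1,\dots,\boldsymbol g_m$ of arity $n$, then it contains the $n$-ary $k$-operation $\boldsymbol h$ given by $h^{(j)}(x)=f^{(j)}\bigl(g_1^{(j)}(x),\dots,g_m^{(j)}(x)\bigr)$ for $1\le j\le k$. Then the set of all $k$-clones on $\{0,1\}$ is countable. Moreover, every $k$-clone on $\{0,1\}$ is finitely generated, that is, it is the smallest $k$-clone containing some finite set of $k$-operations. -/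

import Mathlib

/-- `KOpn A k n` is the type of `n`-ary `k`-operations on `A`: `k`-tuples of functions `A^n → A`. -/
abbrev KOpn (A : Type) (k : ℕ) (n : ℕ) : Type := Fin k → (Fin n → A) → A

/-- `KOp A k` is the type of all finitary `k`-operations on `A`, of positive arity;
an element is a pair of an arity `n ≥ 1` and an `n`-ary `k`-operation. -/
abbrev KOp (A : Type) (k : ℕ) : Type := Σ n : ℕ+, KOpn A k (n : ℕ)

/-- The `n`-ary projection `k`-operation onto the `i`-th variable. -/
def KOpn.proj (A : Type) (k n : ℕ) (i : Fin n) : KOpn A k n :=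
  fun _ x => x i

/-- Coordinatewise composition of an `m`-ary `k`-operation `f` with `m` many
`n`-ary `k`-operations `g 0, …, g (m - 1)`. -/
def KOpn.comp {A : Type} {k m n : ℕ} (f : KOpn A k m) (g : Fin m → KOpn A k n) : KOpn A k n :=
  fun j x => f j (fun i => g i j x)

/-- A set of `k`-operations on `A` is a `k`-clone if it contains all `k`-projections and is
closed under composition. -/
structure IsKClone {A : Type} {k : ℕ} (C : Set (KOp A k)) : Prop where
  proj_mem : ∀ (n : ℕ+) (i : Fin n), (⟨n, KOpn.proj A k n i⟩ : KOp A k) ∈ C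
  comp_mem : ∀ (m n : ℕ+) (f : KOpn A k m) (g : Fin m → KOpn A k n),
    (⟨m, f⟩ : KOp A k) ∈ C → (∀ i, (⟨n, g i⟩ : KOp A k) ∈ C) →
      (⟨n, KOpn.comp f g⟩ : KOp A k) ∈ C

/-- The smallest `k`-clone containing a set `F` of `k`-operations
(see `isKClone_kClo`, `subset_kClo` and `kClo_subset`). -/
def kClo {A : Type} {k : ℕ} (F : Set (KOp A k)) : Set (KOp A k) :=
  ⋂₀ {C : Set (KOp A k) | IsKClone C ∧ F ⊆ C}

theorem isKClone_kClo {A : Type} {k : ℕ} (F : Set (KOp A k)) : IsKClone (kClo F) where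
  proj_mem n i := fun _ hC => hC.1.proj_mem n i
  comp_mem m n f g hf hg := fun C hC =>
    hC.1.comp_mem m n f g (hf C hC) (fun i => hg i C hC)

theorem subset_kClo {A : Type} {k : ℕ} (F : Set (KOp A k)) : F ⊆ kClo F :=
  fun _ hx _ hC => hC.2 hx

theorem kClo_subset {A : Type} {k : ℕ} {F C : Set (KOp A k)} (hC : IsKClone C) (h : F ⊆ C) :
    kClo F ⊆ C :=
  fun _ hx => hx C ⟨hC, h⟩

/-- The closed sets of the closure operator `kClo` are exactly the `k`-clones. -/
theorem kClo_eq_self_iff {A : Type} {k : ℕ} (C : Set (KOp A k)) : C = kClo C ↔ IsKClone C :=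
  ⟨fun h => h ▸ isKClone_kClo C,
    fun h => Set.Subset.antisymm (subset_kClo C) (kClo_subset h Set.Subset.rfl)⟩

/-- A `k`-clone is finitely generated if it is the smallest `k`-clone containing some finite set
of `k`-operations. -/
def IsFinGenKClone {A : Type} {k : ℕ} (C : Set (KOp A k)) : Prop :=
  ∃ F : Set (KOp A k), F.Finite ∧ C = kClo F

/-! ### Separation by complements of affine subspaces -/

/-- The coordinatewise action of a `k`-operation on tuples indexed by `X`, where the coordinate
`y` is of sort `σ y`. -/
def KOpn.act {A X : Type} {k n : ℕ} (f : KOpn A k n) (σ : X → Fin k) (c : Fin n → X → A) : X → A :=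
  fun y => f (σ y) fun i => c i y

/-- The multi-sorted relation `R` is invariant under all `k`-operations in `D`. -/
def IsInvariantRel {A X : Type} {k : ℕ} (D : Set (KOp A k)) (σ : X → Fin k) (R : Set (X → A)) :
    Prop :=
  ∀ (n : ℕ+) (g : KOpn A k n), (⟨n, g⟩ : KOp A k) ∈ D →
    ∀ c : Fin n → X → A, (∀ i, c i ∈ R) → g.act σ c ∈ R

/-- The images of `s` under coordinatewise maps preserving `R` form an invariant relation. It
contains `R` (constant maps) and `s` (identity), so by maximality it must contain `f`. -/
theorem IsInvariantRel.exists_unary {A X : Type} {k : ℕ} {D : Set (KOp A k)} {σ : X → Fin k}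
    {R : Set (X → A)} {f : X → A}
    (hR : Maximal (fun R => IsInvariantRel D σ R ∧ f ∉ R) R) {s : X → A} (hs : s ∉ R) :
    ∃ h : X → A → A, (∀ r ∈ R, (fun y => h y (r y)) ∈ R) ∧ (fun y => h y (s y)) = f := by
  let R' : Set (X → A) :=
    {x | ∃ h : X → A → A, (∀ r ∈ R, (fun y => h y (r y)) ∈ R) ∧ (fun y => h y (s y)) = x}
  have hsub : R ⊆ R' := fun r hr => ⟨fun y _ => r y, fun _ _ => hr, rfl⟩
  have hinv : IsInvariantRel D σ R' := by
    intro n g hg c hc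
    choose h hh hhc using hc
    refine ⟨fun y z => g (σ y) fun i => h i y z, fun r hr => ?_, ?_⟩
    · exact hR.prop.1 n g hg (fun i y => h i y (r y)) fun i => hh i r hr
    · funext y
      exact congrArg (g (σ y)) (funext fun i => congrFun (hhc i) y)
  by_contra hf
  exact hs (hR.le_of_ge ⟨hinv, hf⟩ hsub ⟨fun _ z => z, fun _ hr => hr, rfl⟩)

theorem ZMod.two_eq_add_one_of_ne {a b : ZMod 2} (h : a ≠ b) : a = b + 1 := by
  revert a b; decide

/-- A maximal invariant relation which avoids `f` but contains all tuples that differ from `f` in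
exactly one coordinate is the complement of a coset of a subspace. -/
theorem IsInvariantRel.exists_submodule {X : Type} [Fintype X] {k : ℕ}
    {D : Set (KOp (ZMod 2) k)} {σ : X → Fin k} {R : Set (X → ZMod 2)} {f : X → ZMod 2}
    (hR : Maximal (fun R => IsInvariantRel D σ R ∧ f ∉ R) R)
    (hflip : ∀ y, ∃ r ∈ R, ∀ z, z ≠ y → r z = f z) :
    ∃ V : Submodule (ZMod 2) (X → ZMod 2), ∀ s, s ∈ R ↔ s - f ∉ V := by
  classical
  have hfR : f ∉ R := hR.prop.2
  let V : Submodule (ZMod 2) (X → ZMod 2) :=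
    { carrier := {T | ∀ s ∈ R, s + T ∈ R}
      add_mem' := fun {a b} ha hb s hs => by
        rw [← add_assoc]
        exact hb _ (ha s hs)
      zero_mem' := fun s hs => by rwa [add_zero]
      smul_mem' := fun c T hT s hs => by
        obtain rfl | rfl : c = 0 ∨ c = 1 := by revert c; decide
        · simpa using hs
        · simpa using hT s hs }
  have hV : ∀ {T}, T ∈ V ↔ ∀ s ∈ R, s + T ∈ R := Iff.rfl
  let ind : Finset X → X → ZMod 2 := fun s y => if y ∈ s then 1 else 0
  have two : ∀ a : ZMod 2, a + 1 + 1 = a := by decide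
  have hneg : ∀ T : X → ZMod 2, T + T = 0 := fun T => by
    funext y
    exact CharTwo.add_self_eq_zero (T y)
  -- A set `s` with a smaller nonempty bad subset `t` splits into `t` and `s \ t`. Otherwise the
  -- unary maps sending `f + ind s` to `f` turn out to be exactly translation by `ind s`.
  have key : ∀ s : Finset X, f + ind s ∉ R → ind s ∈ V := by
    intro s
    induction s using Finset.strongInduction with
    | H s ih =>
      intro hs
      by_cases hmin : ∃ t, t ⊂ s ∧ t.Nonempty ∧ f + ind t ∉ R
      · obtain ⟨t, hts, htne, ht⟩ := hmin
        have htV := ih t hts ht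
        have hsum : ind s = ind (s \ t) + ind t := by
          funext y
          have := @hts.1 y
          by_cases h1 : y ∈ s <;> by_cases h2 : y ∈ t <;> simp_all [ind]
        have hss : s \ t ⊂ s := Finset.sdiff_ssubset hts.1 htne
        rw [hsum]
        refine V.add_mem (ih _ hss fun hmem => hs ?_) htV
        rw [hsum, ← add_assoc]
        exact hV.1 htV _ hmem
      · push Not at hmin
        obtain ⟨h, hhR, hhs⟩ := IsInvariantRel.exists_unary hR hs
        have hin : ∀ y ∈ s, h y (f y + 1) = f y := fun y hy => by
          simpa [ind, hy] using congrFun hhs y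
        have hout : ∀ y, y ∉ s → h y (f y) = f y := fun y hy => by
          simpa [ind, hy] using congrFun hhs y
        have hone : ∀ y, f + ind {y} ∈ R := fun y => by
          obtain ⟨r, hr, hry⟩ := hflip y
          have hne : r y ≠ f y := fun h0 => hfR <| by
            convert hr using 1
            funext z
            by_cases hz : z = y
            · rw [hz, h0]
            · rw [hry z hz]
          convert hr using 1
          funext z
          by_cases hz : z = y
          · subst hz
            simp [ind, ZMod.two_eq_add_one_of_ne hne]
          · simp [ind, hz, hry z hz]
        have hin' : ∀ y ∈ s, h y (f y) = f y + 1 := fun y hy => by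
          apply ZMod.two_eq_add_one_of_ne
          intro h0
          have hmem : f + ind (s.erase y) ∈ R := by
            rcases (s.erase y).eq_empty_or_nonempty with he | he
            · exfalso
              apply hs
              have : s = {y} := by
                rw [← Finset.insert_erase hy, he]
                rfl
              rw [this]
              exact hone y
            · exact hmin _ (Finset.erase_ssubset hy) he
          refine hfR ?_
          convert hhR _ hmem using 1
          funext z
          by_cases hz : z = y
          · subst hz
            simp [ind, h0]
          · by_cases hzs : z ∈ s
            · simp [ind, hz, hzs, hin]
            · simp [ind, hzs, hout]
        have hout' : ∀ y, y ∉ s → h y (f y + 1) = f y + 1 := fun y hy => by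
          apply ZMod.two_eq_add_one_of_ne
          intro h0
          refine hs ?_
          convert hhR _ (hone y) using 1
          funext z
          by_cases hz : z = y
          · subst hz
            simp [ind, hy, h0]
          · by_cases hzs : z ∈ s
            · simp [ind, hz, hzs, hin']
            · simp [ind, hz, hzs, hout]
        rw [hV]
        intro r hr
        convert hhR r hr using 1
        funext y
        rcases eq_or_ne (r y) (f y) with e | e
        · by_cases hy : y ∈ s
          · simp [ind, hy, e, hin']
          · simp [ind, hy, e, hout]
        · rw [ZMod.two_eq_add_one_of_ne e]
          by_cases hy : y ∈ s
          · simp [ind, hy, hin, two, ZMod.two_eq_add_one_of_ne e]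
          · simp [ind, hy, hout', ZMod.two_eq_add_one_of_ne e]
  refine ⟨V, fun s => ⟨fun hs hsV => hfR ?_, fun hs => ?_⟩⟩
  · have := hV.1 hsV s hs
    rw [sub_eq_add_neg, neg_eq_of_add_eq_zero_left (hneg f), add_comm s f, ← add_assoc,
      add_comm s f, add_assoc, hneg, add_zero] at this
    exact this
  · by_contra hsR
    refine hs ?_
    have hind : s - f = ind {y | s y - f y = 1} := by
      funext y
      have : ∀ a : ZMod 2, a = if a = 1 then 1 else 0 := by decide
      simpa [ind] using this (s y - f y)
    rw [hind]
    refine key _ ?_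
    rwa [← hind, add_sub_cancel]

/-- Every `k`-operation outside a `k`-clone `D` on a two-element set is separated from `D` by an
invariant relation which is the complement of a coset of a subspace. -/
theorem IsKClone.exists_separating_rel {k : ℕ} {D : Set (KOp (ZMod 2) k)} (hD : IsKClone D)
    {n : ℕ+} {f : KOpn (ZMod 2) k n} (hf : (⟨n, f⟩ : KOp (ZMod 2) k) ∉ D) :
    ∃ (Y : Finset (Fin k × (Fin n → ZMod 2))) (V : Submodule (ZMod 2) (Y → ZMod 2)),
      Nonempty Y ∧
      IsInvariantRel D (fun y : Y => y.1.1) {s | s - (fun y : Y => f y.1.1 y.1.2) ∉ V} ∧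
      ∀ i, (fun y : Y => y.1.2 i - f y.1.1 y.1.2) ∉ V := by
  classical
  let P : Finset (Fin k × (Fin n → ZMod 2)) → Prop := fun Y =>
    ∀ g : KOpn (ZMod 2) k n, (⟨n, g⟩ : KOp (ZMod 2) k) ∈ D → ∃ y ∈ Y, g y.1 y.2 ≠ f y.1 y.2
  have hP : P Finset.univ := by
    intro g hg
    by_contra! h
    refine hf ?_
    convert hg using 2
    funext j a
    exact (h (j, a) (Finset.mem_univ _)).symm
  -- By minimality, for each `y ∈ Y` some member of `D` agrees with `f` on the rest of `Y`; this
  -- yields `hflip`.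
  obtain ⟨Y, hY⟩ := exists_minimal_of_wellFoundedLT P ⟨_, hP⟩
  let f' : Y → ZMod 2 := fun y => f y.1.1 y.1.2
  let σ : Y → Fin k := fun y => y.1.1
  let R₀ : Set (Y → ZMod 2) :=
    {s | ∃ g : KOpn (ZMod 2) k n, (⟨n, g⟩ : KOp (ZMod 2) k) ∈ D ∧ s = fun y => g y.1.1 y.1.2}
  have hR₀ : IsInvariantRel D σ R₀ ∧ f' ∉ R₀ := by
    constructor
    · intro m g hg c hc
      choose e he hec using hc
      refine ⟨KOpn.comp g e, hD.comp_mem m n g e hg he, ?_⟩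
      funext y
      simp [KOpn.act, KOpn.comp, hec, σ]
    · rintro ⟨g, hg, hgf⟩
      obtain ⟨y, hy, hne⟩ := hY.prop g hg
      exact hne (congrFun hgf ⟨y, hy⟩).symm
  obtain ⟨R, hle, hR⟩ :=
    Finite.exists_le_maximal (p := fun R => IsInvariantRel D σ R ∧ f' ∉ R) hR₀
  have hflip : ∀ y, ∃ r ∈ R, ∀ z, z ≠ y → r z = f' z := by
    intro y
    have : ¬ P (Y.erase y) := fun h =>
      (Finset.erase_ssubset y.2).not_ge (hY.le_of_le h (Finset.erase_subset _ _))
    simp only [P] at this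
    push Not at this
    obtain ⟨g, hg, hgY⟩ := this
    exact ⟨fun z => g z.1.1 z.1.2, hle ⟨g, hg, rfl⟩, fun z hz =>
      hgY z (Finset.mem_erase.2 ⟨fun h => hz (Subtype.ext h), z.2⟩)⟩
  obtain ⟨V, hV⟩ := IsInvariantRel.exists_submodule hR hflip
  have hRV : R = {s | s - f' ∉ V} := Set.ext hV
  refine ⟨Y, V, ?_, hRV ▸ hR.prop.1, fun i => (hV _).1 (hle ⟨_, hD.proj_mem n i, rfl⟩)⟩
  obtain ⟨y, hy, -⟩ := hY.prop _ (hD.proj_mem n ⟨0, n.pos⟩)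
  exact ⟨⟨y, hy⟩⟩

/-! ### Well-quasi-ordering of labelled vector families over `ZMod 2` -/

/-- Greedy choice: the span of `T` and the vectors already chosen has at most `2 ^ (T.card +
s.card)` elements, so a class with more distinct vectors contains one outside it. -/
theorem exists_linearIndep_choice {M X I Γ : Type} [AddCommGroup M] [Module (ZMod 2) M]
    [DecidableEq M] [Fintype X] [Nonempty X] [DecidableEq Γ] (cl : X → Γ) (v : X → M) (cI : I → Γ)
    (T : Finset M) (s : Finset I)
    (h : ∀ i ∈ s, 2 ^ (T.card + s.card) < (({x | cl x = cI i} : Finset X).image v).card) :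
    ∃ g : I → X, (∀ i ∈ s, cl (g i) = cI i) ∧ Set.InjOn g s ∧
      ∀ c : I → ZMod 2, ∑ i ∈ s, c i • v (g i) ∈ Submodule.span (ZMod 2) (T : Set M) →
        ∀ i ∈ s, c i = 0 := by
  classical
  induction s using Finset.induction_on with
  | empty => exact ⟨fun _ => Classical.arbitrary X, by simp, by simp, by simp⟩
  | insert a s ha ih =>
    obtain ⟨g, hg, hinj, hind⟩ := ih fun i hi =>
      lt_of_le_of_lt (Nat.pow_le_pow_right two_pos (by rw [Finset.card_insert_of_notMem ha]; omega))
        (h i (Finset.mem_insert_of_mem hi))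
    let S : Finset M := T ∪ s.image fun i => v (g i)
    let W := Submodule.span (ZMod 2) (S : Set M)
    have hScard : S.card ≤ T.card + s.card :=
      (Finset.card_union_le _ _).trans (Nat.add_le_add_left Finset.card_image_le _)
    obtain ⟨x, hxa, hx⟩ : ∃ x, cl x = cI a ∧ v x ∉ W := by
      by_contra! hcon
      have : Module.Finite (ZMod 2) W := Module.Finite.span_of_finite _ S.finite_toSet
      have : Finite W := Module.finite_of_finite (ZMod 2)
      have hle : (({x | cl x = cI a} : Finset X).image v).card ≤ Nat.card W := by
        rw [← Set.ncard_coe_finset]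
        refine Set.ncard_le_ncard (t := (W : Set M)) (fun m hm => ?_) (Set.toFinite (W : Set M))
        obtain ⟨x, hx, rfl⟩ := Finset.mem_image.1 (Finset.mem_coe.1 hm)
        exact hcon x (Finset.mem_filter.1 hx).2
      have hW : Nat.card W ≤ 2 ^ (T.card + s.card) := by
        rw [Module.natCard_eq_pow_finrank (K := ZMod 2), Nat.card_zmod]
        exact Nat.pow_le_pow_right two_pos ((finrank_span_finset_le_card S).trans hScard)
      have := h a (Finset.mem_insert_self _ _)
      have := Nat.pow_le_pow_right two_pos
        (show T.card + s.card ≤ T.card + (insert a s).card by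
          rw [Finset.card_insert_of_notMem ha]; omega)
      omega
    have hne : ∀ i ∈ s, g i ≠ x := fun i hi hix =>
      hx (Submodule.subset_span (Finset.mem_coe.2 (Finset.mem_union_right _
        (Finset.mem_image.2 ⟨i, hi, by rw [hix]⟩))))
    have hia : ∀ i ∈ s, i ≠ a := fun i hi h0 => ha (h0 ▸ hi)
    refine ⟨Function.update g a x, ?_, ?_, ?_⟩
    · intro i hi
      rcases Finset.mem_insert.1 hi with rfl | hi
      · simpa using hxa
      · simpa [hia i hi] using hg i hi
    · intro i hi j hj hij
      rcases Finset.mem_insert.1 (Finset.mem_coe.1 hi) with hi' | hi' <;>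
        rcases Finset.mem_insert.1 (Finset.mem_coe.1 hj) with hj' | hj'
      · rw [hi', hj']
      · rw [hi', Function.update_self, Function.update_of_ne (hia j hj')] at hij
        exact absurd hij.symm (hne j hj')
      · rw [hj', Function.update_self, Function.update_of_ne (hia i hi')] at hij
        exact absurd hij (hne i hi')
      · rw [Function.update_of_ne (hia i hi'), Function.update_of_ne (hia j hj')] at hij
        exact hinj hi' hj' hij
    · intro c hc
      have hsum : ∑ i ∈ s, c i • v (Function.update g a x i) = ∑ i ∈ s, c i • v (g i) :=
        Finset.sum_congr rfl fun i hi => by rw [Function.update_of_ne (hia i hi)]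
      rw [Finset.sum_insert ha, hsum, Function.update_self] at hc
      have hTW : Submodule.span (ZMod 2) (T : Set M) ≤ W :=
        Submodule.span_mono (by simp [S])
      have hsW : ∑ i ∈ s, c i • v (g i) ∈ W := Submodule.sum_mem _ fun i hi =>
        Submodule.smul_mem _ _ (Submodule.subset_span (Finset.mem_coe.2
          (Finset.mem_union_right _ (Finset.mem_image_of_mem _ hi))))
      have hca : c a = 0 := by
        by_contra h0
        refine hx ?_
        have := W.sub_mem (hTW hc) hsW
        rw [add_sub_cancel_right] at this
        exact (W.smul_mem_iff h0).1 this
      rw [hca, zero_smul, zero_add] at hc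
      intro i hi
      rcases Finset.mem_insert.1 hi with rfl | hi
      · exact hca
      · exact hind c hc i hi

/-- With `w` the value of `u` at class representatives, only class sums and the deviations of `u`
from `w` remain. -/
theorem sum_smul_eq_sum_class_add {M X Γ : Type} [AddCommGroup M] [Module (ZMod 2) M] [Fintype X]
    [Fintype Γ] [DecidableEq Γ] (cl : X → Γ) (v : X → M) (w : Γ → ZMod 2) (u : X → ZMod 2) :
    ∑ x, u x • v x = ∑ c, w c • (∑ x with cl x = c, v x) + ∑ x, (u x - w (cl x)) • v x := by
  have : ∑ c, w c • (∑ x with cl x = c, v x) = ∑ x, w (cl x) • v x := by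
    rw [← Finset.sum_fiberwise Finset.univ cl]
    refine Finset.sum_congr rfl fun c _ => ?_
    rw [Finset.smul_sum]
    refine Finset.sum_congr rfl fun x hx => ?_
    rw [(Finset.mem_filter.1 hx).2]
  rw [this, ← Finset.sum_add_distrib]
  exact Finset.sum_congr rfl fun x _ => by rw [← add_smul, add_sub_cancel]

/-- Comparison of two finite families of vectors over `ZMod 2`, divided into classes. In a class in
`small` all vectors are equal. -/
theorem exists_class_preserving_map {X X' M M' Γ : Type} [Fintype X] [Fintype X'] [Nonempty X]
    [Nonempty X'] [AddCommGroup M] [Module (ZMod 2) M] [AddCommGroup M'] [Module (ZMod 2) M']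
    [DecidableEq M'] [Fintype Γ] [DecidableEq Γ] (cl : X → Γ) (cl' : X' → Γ) (v : X → M)
    (v' : X' → M') (small : Set Γ) (q : Γ → M) (q' : Γ → M')
    (hq : ∀ x, cl x ∈ small → v x = q (cl x)) (hq' : ∀ x, cl' x ∈ small → v' x = q' (cl' x))
    (hrel : ∀ a b : Γ → ZMod 2,
      ∑ c, a c • (∑ x with cl' x = c, v' x) + ∑ c, b c • q' c = 0 →
        ∑ c, a c • (∑ x with cl x = c, v x) + ∑ c, b c • q c = 0)
    (hsupp : ∀ x', ∃ x, cl x = cl' x')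
    (hsmall : ∀ c ∈ small,
      ({x | cl x = c} : Finset X).card ≤ ({x | cl' x = c} : Finset X').card)
    (hbig : ∀ x, cl x ∉ small → 2 ^ (2 * Fintype.card Γ + Fintype.card X) <
      (({x' | cl' x' = cl x} : Finset X').image v').card) :
    ∃ φ : X' → X, (∀ x, cl (φ x) = cl' x) ∧
      ∀ u : X → ZMod 2, ∑ x, u (φ x) • v' x = 0 → ∑ x, u x • v x = 0 := by
  classical
  let rep : Γ → X := fun c => if h : ∃ x, cl x = c then h.choose else Classical.arbitrary X
  have hrep : ∀ x, cl (rep (cl x)) = cl x := fun x => by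
    have h : ∃ y, cl y = cl x := ⟨x, rfl⟩
    simp only [rep, dif_pos h]
    exact h.choose_spec
  let N : Finset X := {x | x ≠ rep (cl x)}
  let NB : Finset X := {x ∈ N | cl x ∉ small}
  let t' : Γ → M' := fun c => ∑ x with cl' x = c, v' x
  let T : Finset M' := Finset.univ.image t' ∪ Finset.univ.image q'
  have hTcard : T.card ≤ 2 * Fintype.card Γ := by
    refine (Finset.card_union_le _ _).trans ?_
    have h1 : (Finset.univ.image t').card ≤ Fintype.card Γ := Finset.card_image_le
    have h2 : (Finset.univ.image q').card ≤ Fintype.card Γ := Finset.card_image_le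
    omega
  obtain ⟨g, hg, hginj, hgind⟩ := exists_linearIndep_choice cl' v' cl T NB fun x hx =>
    lt_of_le_of_lt (Nat.pow_le_pow_right two_pos (Nat.add_le_add hTcard (Finset.card_le_univ _)))
      (hbig x (Finset.mem_filter.1 hx).2)
  have hemb : ∀ c, ∃ e : X → X', c ∈ small →
      (∀ x, cl x = c → cl' (e x) = c) ∧ Set.InjOn e {x | cl x = c} := by
    intro c
    by_cases hc : c ∈ small
    · obtain ⟨e⟩ := Function.Embedding.nonempty_of_card_le
        (α := {x // cl x = c}) (β := {x // cl' x = c})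
        (by simpa only [Fintype.card_subtype] using hsmall c hc)
      refine ⟨fun x => if h : cl x = c then (e ⟨x, h⟩).1 else Classical.arbitrary X',
        fun _ => ⟨fun x hx => ?_, fun x hx y hy hxy => ?_⟩⟩
      · simp only [dif_pos hx]
        exact (e ⟨x, hx⟩).2
      · rw [Set.mem_ofPred_eq] at hx hy
        simp only [dif_pos hx, dif_pos hy] at hxy
        exact congrArg Subtype.val (e.injective (Subtype.ext hxy))
    · exact ⟨fun _ => Classical.arbitrary X', fun h => absurd h hc⟩
  choose e he using hemb
  let G : X → X' := fun x => if cl x ∈ small then e (cl x) x else g x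
  have hG : ∀ x ∈ N, cl' (G x) = cl x := by
    intro x hx
    by_cases hc : cl x ∈ small
    · simp only [G, if_pos hc]
      exact (he _ hc).1 x rfl
    · simp only [G, if_neg hc]
      exact hg x (Finset.mem_filter.2 ⟨hx, hc⟩)
  have hGinj : Set.InjOn G N := by
    intro x hx y hy hxy
    have hcl : cl x = cl y := by rw [← hG x hx, ← hG y hy, hxy]
    by_cases hc : cl x ∈ small
    · have hc' : cl y ∈ small := hcl ▸ hc
      simp only [G, if_pos hc, if_pos hc', ← hcl] at hxy
      exact (he _ hc).2 rfl hcl.symm hxy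
    · have hc' : cl y ∉ small := hcl ▸ hc
      simp only [G, if_neg hc, if_neg hc'] at hxy
      exact hginj (Finset.mem_coe.2 (Finset.mem_filter.2 ⟨hx, hc⟩))
        (Finset.mem_coe.2 (Finset.mem_filter.2 ⟨hy, hc'⟩)) hxy
  -- Each non-representative `x` has the single preimage `G x`; everything else collapses to its
  -- class representative, where the deviation `d` vanishes.
  let φ : X' → X := fun x' => if h : ∃ x ∈ N, G x = x' then h.choose else rep (cl' x')
  have hφG : ∀ x ∈ N, φ (G x) = x := by
    intro x hx
    have h : ∃ y ∈ N, G y = G x := ⟨x, hx, rfl⟩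
    simp only [φ, dif_pos h]
    exact hGinj h.choose_spec.1 hx h.choose_spec.2
  have hφ : ∀ x', x' ∉ N.image G → φ x' = rep (cl' x') := fun x' hx' =>
    dif_neg fun h => hx' (Finset.mem_image.2 h)
  have hφcl : ∀ x', cl (φ x') = cl' x' := by
    intro x'
    by_cases hx' : x' ∈ N.image G
    · obtain ⟨x, hx, rfl⟩ := Finset.mem_image.1 hx'
      rw [hφG x hx, hG x hx]
    · obtain ⟨x, hx⟩ := hsupp x'
      rw [hφ x' hx', ← hx, hrep]
  refine ⟨φ, hφcl, fun u hu => ?_⟩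
  let w : Γ → ZMod 2 := fun c => u (rep c)
  let d : X → ZMod 2 := fun x => u x - w (cl x)
  let b : Γ → ZMod 2 := fun c => ∑ x ∈ N with cl x ∈ small ∧ cl x = c, d x
  have hsplit : ∀ {L : Type} [AddCommGroup L] [Module (ZMod 2) L] (p : X → L) (r : Γ → L),
      (∀ x ∈ N, cl x ∈ small → p x = r (cl x)) →
      ∑ x ∈ N, d x • p x = ∑ x ∈ NB, d x • p x + ∑ c, b c • r c := by
    intro L _ _ p r hpr
    rw [← Finset.sum_filter_add_sum_filter_not N (fun x => cl x ∉ small)]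
    congr 1
    rw [← Finset.sum_fiberwise _ cl]
    refine Finset.sum_congr rfl fun c _ => ?_
    rw [Finset.sum_smul, Finset.filter_filter]
    simp only [not_not]
    refine Finset.sum_congr rfl fun x hx => ?_
    obtain ⟨hxN, hxs, rfl⟩ := Finset.mem_filter.1 hx
    rw [hpr x hxN hxs]
  have hX : ∑ x, u x • v x = ∑ c, w c • (∑ x with cl x = c, v x) +
      (∑ x ∈ NB, d x • v x + ∑ c, b c • q c) := by
    rw [sum_smul_eq_sum_class_add cl v w u, ← hsplit v q fun x _ hx => hq x hx]
    congr 1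
    refine (Finset.sum_subset (Finset.subset_univ _) fun x _ hx => ?_).symm
    have : x = rep (cl x) := by simpa [N] using hx
    simp only [w, ← this, sub_self, zero_smul]
  have hX' : ∑ x, u (φ x) • v' x = ∑ c, w c • t' c +
      (∑ x ∈ NB, d x • v' (G x) + ∑ c, b c • q' c) := by
    rw [sum_smul_eq_sum_class_add cl' v' w fun x => u (φ x), ← hsplit (fun x => v' (G x)) q'
      fun x hxN hx => by rw [hq' _ (by rwa [hG x hxN]), hG x hxN]]
    congr 1
    rw [← Finset.sum_subset (Finset.subset_univ (N.image G)) fun x _ hx => by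
      simp only [hφ x hx, w, sub_self, zero_smul], Finset.sum_image hGinj]
    refine Finset.sum_congr rfl fun x hx => ?_
    simp only [hφG x hx, hG x hx, d]
  -- The chosen big-class vectors are independent modulo the class sums and the `q' c`, so what
  -- survives is a relation covered by `hrel`.
  have hd : ∀ x ∈ NB, d x = 0 := by
    refine hgind d ?_
    have hNB : ∑ x ∈ NB, d x • v' (g x) = ∑ x ∈ NB, d x • v' (G x) :=
      Finset.sum_congr rfl fun x hx => by simp only [G, if_neg (Finset.mem_filter.1 hx).2]
    have heq : ∑ x ∈ NB, d x • v' (G x) = -(∑ c, w c • t' c + ∑ c, b c • q' c) := by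
      rw [eq_neg_iff_add_eq_zero, ← hu, hX']
      abel
    rw [hNB, heq]
    refine Submodule.neg_mem _ (Submodule.add_mem _ ?_ ?_) <;>
      refine Submodule.sum_mem _ fun c _ => Submodule.smul_mem _ _ (Submodule.subset_span ?_)
    · simp [T]
    · simp [T]
  have hzero : ∀ {L : Type} [AddCommGroup L] [Module (ZMod 2) L] (p : X → L),
      ∑ x ∈ NB, d x • p x = 0 := fun p =>
    Finset.sum_eq_zero fun x hx => by rw [hd x hx, zero_smul]
  rw [hX, hzero, zero_add]
  refine hrel w b ?_
  rw [hX', hzero, zero_add] at hu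
  exact hu

theorem Finset.exists_injOn_fin {M : Type} (S : Finset M) {K : ℕ} (hS : S.card ≤ K) :
    ∃ e : M → Fin (K + 1), Set.InjOn e S := by
  classical
  refine ⟨fun m => if h : m ∈ S then
    ⟨S.equivFin ⟨m, h⟩, ((S.equivFin ⟨m, h⟩).2.trans_le hS).trans (Nat.lt_succ_self K)⟩ else 0,
    fun x hx y hy hxy => ?_⟩
  rw [Finset.mem_coe] at hx hy
  simp only [dif_pos hx, dif_pos hy, Fin.mk.injEq, Fin.val_inj] at hxy
  exact congrArg Subtype.val (S.equivFin.injective hxy)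

theorem exists_label_preserving_map_of_monotone {Λ : Type} [Finite Λ] [DecidableEq Λ]
    (X M : ℕ → Type)
    [∀ i, Fintype (X i)] [∀ i, Nonempty (X i)] [∀ i, AddCommGroup (M i)]
    [∀ i, Module (ZMod 2) (M i)] [∀ i, DecidableEq (M i)] (l : ∀ i, X i → Λ) (v : ∀ i, X i → M i)
    (hmono : Monotone fun i (c : Λ) => (({x | l i x = c} : Finset (X i)).image (v i)).card) :
    ∃ i j, i < j ∧ ∃ φ : X j → X i, (∀ x, l i (φ x) = l j x) ∧
      ∀ u : X i → ZMod 2, ∑ x, u (φ x) • v j x = 0 → ∑ x, u x • v i x = 0 := by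
  classical
  have := Fintype.ofFinite Λ
  let a : ℕ → Λ → ℕ := fun i c => (({x | l i x = c} : Finset (X i)).image (v i)).card
  -- Labels outside `B` carry boundedly many distinct vectors, so they can be refined by the vector
  -- itself into finitely many classes, as `cl` does below.
  let B : Set Λ := {c | ∀ K, ∃ i, K < a i c}
  obtain ⟨K, hK⟩ : ∃ K, ∀ c ∉ B, ∀ i, a i c ≤ K := by
    have : ∀ c, ∃ K, c ∉ B → ∀ i, a i c ≤ K := fun c => by
      by_cases hc : c ∈ B
      · exact ⟨0, fun h => absurd hc h⟩
      · simp only [B, Set.mem_ofPred_eq] at hc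
        push Not at hc
        exact hc.imp fun K hK _ => hK
    choose K hK using this
    exact ⟨∑ c, K c, fun c hc i =>
      (hK c hc i).trans (Finset.single_le_sum (fun _ _ => Nat.zero_le _) (Finset.mem_univ c))⟩
  have henc : ∀ i (c : Λ), ∃ e : M i → Fin (K + 1),
      c ∉ B → Set.InjOn e (({x | l i x = c} : Finset (X i)).image (v i)) := fun i c => by
    by_cases hc : c ∈ B
    · exact ⟨fun _ => 0, fun h => absurd hc h⟩
    · exact (Finset.exists_injOn_fin _ (hK c hc i)).imp fun e he _ => he
  choose e he using henc
  let Γ := Λ × Fin (K + 1)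
  let cl : ∀ i, X i → Γ := fun i x => (l i x, if l i x ∈ B then 0 else e i (l i x) (v i x))
  let small : Set Γ := {c | c.1 ∉ B}
  have hq : ∀ i, ∃ q : Γ → M i, ∀ x, cl i x ∈ small → v i x = q (cl i x) := by
    intro i
    refine ⟨fun c => if h : ∃ x, cl i x = c then v i h.choose else 0, fun x hx => ?_⟩
    have h : ∃ y, cl i y = cl i x := ⟨x, rfl⟩
    simp only [dif_pos h]
    have hl : l i h.choose = l i x := congrArg Prod.fst h.choose_spec
    have hv : (if l i h.choose ∈ B then 0 else e i (l i h.choose) (v i h.choose)) =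
      if l i x ∈ B then 0 else e i (l i x) (v i x) := congrArg Prod.snd h.choose_spec
    have hxB : l i x ∉ B := hx
    rw [hl, if_neg hxB, if_neg hxB] at hv
    exact (he i _ hxB (by simpa using ⟨_, hl, rfl⟩) (by simpa using ⟨x, rfl, rfl⟩) hv).symm
  choose q hq using hq
  let rel : ℕ → Set ((Γ → ZMod 2) × (Γ → ZMod 2)) := fun i =>
    {p | ∑ c, p.1 c • (∑ x with cl i x = c, v i x) + ∑ c, p.2 c • q i c = 0}
  let supp : ℕ → Set Γ := fun i => Set.range (cl i)
  let m : ℕ → Γ → ℕ := fun i c => ({x | cl i x = c} : Finset (X i)).card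
  -- Relations and supports range over finite types and are compared by equality; multiplicities are
  -- handled by Dickson's lemma.
  have hwqo : WellQuasiOrdered fun p p' : (Set ((Γ → ZMod 2) × (Γ → ZMod 2)) × Set Γ) × (Γ → ℕ) =>
      p.1 = p'.1 ∧ p.2 ≤ p'.2 :=
    (Finite.wellQuasiOrdered (· = ·)).prod wellQuasiOrdered_le
  have : IsPreorder _ fun p p' : (Set ((Γ → ZMod 2) × (Γ → ZMod 2)) × Set Γ) × (Γ → ℕ) =>
      p.1 = p'.1 ∧ p.2 ≤ p'.2 :=
    { refl := fun _ => ⟨rfl, le_rfl⟩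
      trans := fun _ _ _ h h' => ⟨h.1.trans h'.1, h.2.trans h'.2⟩ }
  obtain ⟨g, hg⟩ := hwqo.exists_monotone_subseq fun i => ((rel i, supp i), m i)
  -- This bound depends only on the first family, so a late enough second family exceeds it in every
  -- label of `B`.
  let b := 2 ^ (2 * Fintype.card Γ + Fintype.card (X (g 0)))
  obtain ⟨n, hn⟩ : ∃ n, ∀ c ∈ B, ∀ j, n ≤ j → b < a j c := by
    have : ∀ c, ∃ n, c ∈ B → ∀ j, n ≤ j → b < a j c := fun c => by
      by_cases hc : c ∈ B
      · obtain ⟨n, hn⟩ := hc b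
        exact ⟨n, fun _ j hj => hn.trans_le (hmono hj c)⟩
      · exact ⟨0, fun h => absurd h hc⟩
    choose n hn using this
    exact ⟨∑ c, n c, fun c hc j hj => hn c hc j
      ((Finset.single_le_sum (fun _ _ => Nat.zero_le _) (Finset.mem_univ c)).trans hj)⟩
  have hle := hg 0 (n + 1) (Nat.zero_le _)
  have hrel : rel (g 0) = rel (g (n + 1)) := congrArg Prod.fst hle.1
  have hsupp : supp (g 0) = supp (g (n + 1)) := congrArg Prod.snd hle.1
  have hlarge : n ≤ g (n + 1) := (Nat.le_succ n).trans g.strictMono.le_apply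
  obtain ⟨φ, hφ, hsum⟩ := exists_class_preserving_map (cl (g 0)) (cl (g (n + 1))) (v (g 0))
    (v (g (n + 1))) small (q (g 0)) (q (g (n + 1))) (hq _) (hq _)
    (fun a b h => by
      have : (a, b) ∈ rel (g (n + 1)) := h
      rw [← hrel] at this
      exact this)
    (fun x' => by
      have : cl (g (n + 1)) x' ∈ supp (g (n + 1)) := ⟨x', rfl⟩
      rw [← hsupp] at this
      exact this)
    (fun c _ => hle.2 c)
    (fun x hx => by
      have hxB : l (g 0) x ∈ B := not_not.1 hx
      have hcl : ∀ (i : ℕ) (y : X i), cl i y = cl (g 0) x ↔ l i y = l (g 0) x := by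
        intro i y
        constructor
        · exact congrArg Prod.fst
        · intro h
          simp only [cl, h, if_pos hxB]
      simpa only [hcl] using hn _ hxB _ hlarge)
  exact ⟨g 0, g (n + 1), g.strictMono n.succ_pos, φ, fun x => congrArg Prod.fst (hφ x), hsum⟩

/-- A well-quasi-ordering property of finite labelled families of vectors over `ZMod 2`. -/
theorem exists_label_preserving_map {Λ : Type} [Finite Λ] (X M : ℕ → Type)
    [∀ i, Fintype (X i)] [∀ i, Nonempty (X i)] [∀ i, AddCommGroup (M i)]
    [∀ i, Module (ZMod 2) (M i)] (l : ∀ i, X i → Λ) (v : ∀ i, X i → M i) :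
    ∃ i j, i < j ∧ ∃ φ : X j → X i, (∀ x, l i (φ x) = l j x) ∧
      ∀ u : X i → ZMod 2, ∑ x, u (φ x) • v j x = 0 → ∑ x, u x • v i x = 0 := by
  classical
  obtain ⟨g, hg⟩ := (wellQuasiOrdered_le (α := Λ → ℕ)).exists_monotone_subseq
    fun i c => (({x | l i x = c} : Finset (X i)).image (v i)).card
  obtain ⟨i, j, hij, h⟩ := exists_label_preserving_map_of_monotone (fun i => X (g i))
    (fun i => M (g i)) (fun i => l (g i)) (fun i => v (g i)) fun i j hij => hg i j hij
  exact ⟨g i, g j, g.strictMono hij, h⟩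

/-- A version of `exists_label_preserving_map` for subspaces of `X → ZMod 2`. -/
theorem exists_label_preserving_comap_le {Λ : Type} [Finite Λ] (X : ℕ → Type)
    [∀ i, Fintype (X i)] [∀ i, Nonempty (X i)] (l : ∀ i, X i → Λ)
    (V : ∀ i, Submodule (ZMod 2) (X i → ZMod 2)) :
    ∃ i j, i < j ∧ ∃ φ : X j → X i, (∀ x, l i (φ x) = l j x) ∧
      ∀ u : X i → ZMod 2, u ∘ φ ∈ V j → u ∈ V i := by
  classical
  -- A subspace is the space of linear relations among the images of the unit vectors in its
  -- quotient.
  have hmem : ∀ i (u : X i → ZMod 2),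
      ∑ x, u x • (V i).mkQ (Pi.single x 1) = 0 ↔ u ∈ V i := by
    intro i u
    rw [← Submodule.Quotient.mk_eq_zero, ← Submodule.mkQ_apply]
    conv_rhs => rw [pi_eq_sum_univ' u, map_sum]
    simp only [map_smul]
  obtain ⟨i, j, hij, φ, hφ, h⟩ := exists_label_preserving_map X (fun i => (X i → ZMod 2) ⧸ V i) l
    fun i x => (V i).mkQ (Pi.single x 1)
  exact ⟨i, j, hij, φ, hφ, fun u hu => (hmem i u).1 (h u ((hmem j _).2 hu))⟩

/-! ### Finite generation and countability -/

theorem IsKClone.isFinGenKClone_zmod_two {k : ℕ} {C : Set (KOp (ZMod 2) k)} (hC : IsKClone C) :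
    IsFinGenKClone C := by
  classical
  by_contra hfg
  have hpick : ∀ F : Finset (KOp (ZMod 2) k), ∃ f, ↑F ⊆ C → f ∈ C ∧ f ∉ kClo (F : Set _) := by
    intro F
    by_cases hF : ↑F ⊆ C
    · by_contra! h
      exact hfg ⟨F, F.finite_toSet, Set.Subset.antisymm (fun f hf => (h f).2 hf) (kClo_subset hC hF)⟩
    · exact ⟨⟨1, KOpn.proj _ _ _ 0⟩, fun h => absurd h hF⟩
  choose p hp using hpick
  obtain ⟨F, hF₀, hFs⟩ : ∃ F : ℕ → Finset (KOp (ZMod 2) k),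
      F 0 = ∅ ∧ ∀ i, F (i + 1) = insert (p (F i)) (F i) :=
    ⟨fun i => Nat.rec ∅ (fun _ S => insert (p S) S) i, rfl, fun _ => rfl⟩
  have hFC : ∀ i, (F i : Set (KOp (ZMod 2) k)) ⊆ C := by
    intro i
    induction i with
    | zero => simp [hF₀]
    | succ i ih =>
      rw [hFs, Finset.coe_insert]
      exact Set.insert_subset (hp _ ih).1 ih
  have hFmono : Monotone F := monotone_nat_of_le_succ fun i => by
    rw [hFs]
    exact Finset.subset_insert _ _
  have hmem : ∀ {i j}, i < j → p (F i) ∈ F j := fun {i j} hij =>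
    hFmono (Nat.succ_le_of_lt hij) (by rw [Nat.succ_eq_add_one, hFs]; exact Finset.mem_insert_self _ _)
  choose Y V hY hinv hproj using fun i =>
    (isKClone_kClo (F i : Set (KOp (ZMod 2) k))).exists_separating_rel (hp _ (hFC i)).2
  obtain ⟨i, j, hij, φ, hφ, hV⟩ := exists_label_preserving_comap_le (Λ := Fin k × ZMod 2)
    (fun i => Y i) (fun i y => (y.1.1, (p (F i)).2 y.1.1 y.1.2)) V
  have hφ₁ : ∀ x, (φ x).1.1 = x.1.1 := fun x => congrArg Prod.fst (hφ x)
  have hφ₂ : ∀ x, (p (F i)).2 (φ x).1.1 (φ x).1.2 = (p (F j)).2 x.1.1 x.1.2 :=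
    fun x => congrArg Prod.snd (hφ x)
  have := hinv j (p (F i)).1 (p (F i)).2 (subset_kClo _ (hmem hij)) (fun t x => (φ x).1.2 t)
    fun t ht => hproj i t <| hV _ <| by
      convert ht using 1
      funext x
      simp [hφ₂]
  refine this ?_
  convert (V j).zero_mem using 1
  funext x
  simp only [KOpn.act, Pi.sub_apply, Pi.zero_apply, ← hφ₂, hφ₁, sub_self]

theorem mainTheorem8 (k : ℕ) (hk : 1 ≤ k) :
    {C : Set (KOp (Fin 2) k) | IsKClone C}.Countable ∧
      ∀ C : Set (KOp (Fin 2) k), IsKClone C → IsFinGenKClone C := by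
  have hfg : ∀ C : Set (KOp (Fin 2) k), IsKClone C → IsFinGenKClone C :=
    -- `ZMod 2` is definitionally `Fin 2`.
    fun C hC => IsKClone.isFinGenKClone_zmod_two (k := k) (C := C) hC
  refine ⟨?_, hfg⟩
  refine (Set.countable_range fun F : Finset (KOp (Fin 2) k) => kClo (F : Set _)).mono ?_
  rintro C hC
  obtain ⟨F, hF, rfl⟩ := hfg C hC
  exact ⟨hF.toFinset, by simp⟩
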